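/- **Setting.** A one-counter net (OCN) $N=(Q,\mathit{Act},\delta)$ consists of finite sets $Q$ of control states and $\mathit{Act}$ of actions, and a transition relation $\delta\subseteq Q\times\mathit{Act}\times\{-1,0,1\}\times Q$. It induces a labelled transition system on the configurations $pm\in Q\times\mathbb N$: $pm\xrightarrow{a}p'm'$ iff $(p,a,d,p')\in\delta$ for some $d$ with $m'=m+d\ge 0$. Fix an internal action $\tau\in\mathit{Act}$. Weak steps are $\overset{\tau}{\Longrightarrow}=(\xrightarrow{\tau})^*$ and $\overset{a}{\Longrightarrow}=(\xrightarrow{\tau})^*\cdot\xrightarrow{a}\cdot(\xrightarrow{\tau})^*$ for $a\ne\tau$. For two (possibly equal) nets $M,N$ over the same actions, a relation $R$ between configurations of $M$ and of $N$ is a weak simulation if $s\,R\,t$ and $s\xrightarrow{a}s'$ (any $a\in\mathit{Act}$) imply $t\overset{a}{\Longrightarrow}t'$ and $s'\,R\,t'$ for some $t'$; $\leqq$ is the largest weak simulation. The weak simulation approximants $\leqq_\alpha$, for ordinals $\alpha$, are defined as follows: $\leqq_0$ is the full relation; $s\leqq_{\alpha+1}t$ iff for all $s\xrightarrow{a}s'$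 there is $t\overset{a}{\Longrightarrow}t'$ with $s'\leqq_\alpha t'$; and $\leqq_\lambda=\bigcap_{\alpha<\lambda}\leqq_\alpha$ for limit ordinals $\lambda$. **Theorem.** Weak simulation approximants on OCN converge at level $\omega^2$, but not earlier in general. That is: 1. For all one-counter nets $M,N$ over the same finite set of actions and every choice of $\tau$, the relations $\leqq_{\omega^2}$ and $\leqq$ between configurations of $M$ and $N$ coincide. 2. Let $\mathit{Act}=\{a,\tau\}$ with $a\neq\tau$, let $P$ be the net with one state $p$ and one transition $(p,a,0,p)$, and for $i\in\mathbb N$ let $N_i$ be the net with states $q_0,\dots,q_i,q_0',\dots,q_{i-1}'$ and transitions $$(q_k,a,-1,q_k),\quad (q_{k-1},\tau,0,q_{k-1}'),\quad (q_{k-1}',\tau,1,q_{k-1}'),\quad (q_{k-1}',a,0,q_k)\qquad(1\le k\le i).$$ Then for all $i,m\in\mathbb N$, $pm\leqq_{\omega\cdot i}q_00$ but $pm\not\leqq q_00$. Hence $\leqq_{\omega\cdot i}\;\neq\;\leqq$ between $P$ and $N_i$. 3. Consequently, for every ordinal $\alpha<\omega^2$ there is a one-counter net over $\{a,\tau\}$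 on whose configurations $\leqq_\alpha\;\neq\;\leqq$. -/

import Mathlib

universe u v w

/-- A labelled transition system with state set `V` and action set `Act`. -/
structure LTS (V : Type u) (Act : Type v) where
  step : V → Act → V → Prop

namespace LTS

variable {V : Type u} {V' : Type w} {Act : Type v}

/-- The reflexive transitive closure of the internal (`τ`-labelled) steps. -/
def silent (T : LTS V Act) (τ : Act) : V → V → Prop :=
  Relation.ReflTransGen (fun s t => T.step s τ t)

/-- Weak steps: a weak `τ`-step is a finite sequence of `τ`-steps; for `a ≠ τ`, a weak `a`-step is
an `a`-step preceded and followed by finite sequences of `τ`-steps. -/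
def weakStep (T : LTS V Act) (τ : Act) (s : V) (a : Act) (t : V) : Prop :=
  (a = τ ∧ T.silent τ s t) ∨
    (a ≠ τ ∧ ∃ x y, T.silent τ s x ∧ T.step x a y ∧ T.silent τ y t)

/-- `R` is closed under one round of the weak simulation game after which `R'` has to hold:
Spoiler makes a step in `S` from `s`, and Duplicator answers with a weak step in `T` from `t`. -/
def WeakMatch (τ : Act) (S : LTS V Act) (T : LTS V' Act) (R' : V → V' → Prop)
    (s : V) (t : V') : Prop :=
  ∀ a s', S.step s a s' → ∃ t', T.weakStep τ t a t' ∧ R' s' t'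

/-- Weak simulations between the states of `S` and those of `T` (over the same actions).
The usual notion on a single system is the case `S = T`. -/
def IsWeakSimulation (τ : Act) (S : LTS V Act) (T : LTS V' Act) (R : V → V' → Prop) : Prop :=
  ∀ s t, R s t → WeakMatch τ S T R s t

/-- The weak simulation preorder: the union of all weak simulations, which is the largest one. -/
def WeakSim (τ : Act) (S : LTS V Act) (T : LTS V' Act) (s : V) (t : V') : Prop :=
  ∃ R : V → V' → Prop, IsWeakSimulation τ S T R ∧ R s t

/-- The weak simulation approximants: the full relation at `0`, one more round at successors,
intersections at limits. -/
noncomputable def WeakApprox (τ : Act) (S : LTS V Act) (T : LTS V' Act) (α : Ordinal.{0}) :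
    V → V' → Prop :=
  Ordinal.limitRecOn (motive := fun _ => V → V' → Prop) α
    (fun _ _ => True)
    (fun _ R => WeakMatch τ S T R)
    (fun l _ R s t => ∀ (β : Ordinal.{0}) (h : β < l), R β h s t)

theorem weakApprox_zero (τ : Act) (S : LTS V Act) (T : LTS V' Act) (s : V) (t : V') :
    WeakApprox τ S T 0 s t ↔ True := by
  simp [WeakApprox]

theorem weakApprox_succ (τ : Act) (S : LTS V Act) (T : LTS V' Act) (α : Ordinal.{0})
    (s : V) (t : V') :
    WeakApprox τ S T (Order.succ α) s t ↔
      ∀ a s', S.step s a s' → ∃ t', T.weakStep τ t a t' ∧ WeakApprox τ S T α s' t' := by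
  simp [WeakApprox, WeakMatch]

theorem weakApprox_limit (τ : Act) (S : LTS V Act) (T : LTS V' Act) (l : Ordinal.{0})
    (hl : Order.IsSuccLimit l) (s : V) (t : V') :
    WeakApprox τ S T l s t ↔ ∀ β < l, WeakApprox τ S T β s t := by
  rw [WeakApprox, Ordinal.limitRecOn_limit _ _ _ _ hl]
  rfl

/-- The weak simulation preorder is itself a weak simulation. -/
theorem isWeakSimulation_weakSim (τ : Act) (S : LTS V Act) (T : LTS V' Act) :
    IsWeakSimulation τ S T (WeakSim τ S T) := by
  rintro s t ⟨R, hR, hst⟩ a s' hs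
  obtain ⟨t', ht, hst'⟩ := hR s t hst a s' hs
  exact ⟨t', ht, R, hR, hst'⟩

end LTS

/-- A one-counter net: a finite set `Q` of control states, a finite set `Act` of actions and
transitions `(p, a, d, q)` with counter effect `d ∈ {-1, 0, 1}`; there are no zero tests. -/
structure OneCounterNet (Q : Type u) (Act : Type v) [Finite Q] [Finite Act] where
  δ : Set (Q × Act × ℤ × Q)
  effect_mem : ∀ p a d q, (p, a, d, q) ∈ δ → d = -1 ∨ d = 0 ∨ d = 1

/-- The transition system of a one-counter net, on configurations `(p, m)` with `m : ℕ`. -/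
def OneCounterNet.lts {Q : Type u} {Act : Type v} [Finite Q] [Finite Act]
    (N : OneCounterNet Q Act) : LTS (Q × ℕ) Act where
  step c a c' := ∃ d : ℤ, (c.1, a, d, c'.1) ∈ N.δ ∧ (c'.2 : ℤ) = (c.2 : ℤ) + d

/-- The two actions of the example nets: a visible action and the internal one. -/
inductive ExAct : Type
  | a : ExAct
  | tau : ExAct

instance : Finite ExAct :=
  Finite.of_surjective (fun b : Bool => if b then ExAct.a else ExAct.tau)
    (by rintro (_ | _); exacts [⟨true, rfl⟩, ⟨false, rfl⟩])

/-- The net with a single state `p` and the single transition `(p, a, 0, p)`. -/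
def loopNet : OneCounterNet Unit ExAct where
  δ := {((), ExAct.a, 0, ())}
  effect_mem := by
    intro p a d q h
    simp only [Set.mem_singleton_iff, Prod.mk.injEq] at h
    exact Or.inr (Or.inl h.2.2.1)

/-- The net `N_i`. Its states are `q_0, …, q_i` (`Sum.inl`) and `q'_0, …, q'_{i-1}` (`Sum.inr`).
Its transitions are, for every `k` with `1 ≤ k ≤ i`,
`(q_k, a, -1, q_k)`, `(q_{k-1}, τ, 0, q'_{k-1})`, `(q'_{k-1}, τ, 1, q'_{k-1})` and
`(q'_{k-1}, a, 0, q_k)`. The index `j : Fin i` below is `k - 1`. -/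
def chainNet (i : ℕ) : OneCounterNet (Fin (i + 1) ⊕ Fin i) ExAct where
  δ := {t | ∃ j : Fin i,
    t = (Sum.inl j.succ, ExAct.a, -1, Sum.inl j.succ) ∨
    t = (Sum.inl j.castSucc, ExAct.tau, 0, Sum.inr j) ∨
    t = (Sum.inr j, ExAct.tau, 1, Sum.inr j) ∨
    t = (Sum.inr j, ExAct.a, 0, Sum.inl j.succ)}
  effect_mem := by
    rintro p a d q ⟨j, h | h | h | h⟩ <;> simp only [Prod.mk.injEq] at h <;> simp [h.2.2.1]

/-! Convergence: bigger counters only help (`weakApprox_mono`), so for each pair of states level `ω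
* k` yields a threshold in `ℕ∞`: the counter value from which Spoiler beats every counter value of
Duplicator. Thresholds fall as `k` grows, and a descending sequence of finite tuples over `ℕ∞`
stalls, so levels `ω * k` and `ω * (k + 1)` eventually have equal thresholds. Then level `ω * (k +
1)` is already a weak simulation (`isWeakSimulation_weakApprox_add_omega`): either a largest answer
serves all finite stages at once, or answers are unbounded and the threshold applies.

Sharpness: in `chainNet i` Duplicator may pump the counter before entering each of `i` decrementing
loops; each such choice survives `ω` further rounds, yet every play is finite. -/

namespace LTS

/-! ### Approximants of arbitrary transition systems -/

section General

variable {V : Type u} {V' : Type w} {Act : Type v}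

theorem WeakMatch.mono {τ : Act} {S : LTS V Act} {T : LTS V' Act} {R R' : V → V' → Prop}
    (h : ∀ s t, R s t → R' s t) {s : V} {t : V'} (hm : WeakMatch τ S T R s t) :
    WeakMatch τ S T R' s t := by
  intro a s' hs
  obtain ⟨t', ht, hr⟩ := hm a s' hs
  exact ⟨t', ht, h _ _ hr⟩

theorem weakApprox_of_forall_lt (τ : Act) (S : LTS V Act) (T : LTS V' Act) (α : Ordinal.{0}) :
    ∀ s t, (∀ γ < α, WeakMatch τ S T (WeakApprox τ S T γ) s t) → WeakApprox τ S T α s t := by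
  induction α using Ordinal.limitRecOn with
  | zero => intro s t _; exact (weakApprox_zero τ S T s t).2 trivial
  | add_one β _ =>
    intro s t h
    rw [← Order.succ_eq_add_one] at h ⊢
    exact (weakApprox_succ τ S T β s t).2 (h β (Order.lt_succ β))
  | limit l hl ih =>
    intro s t h
    exact (weakApprox_limit τ S T l hl s t).2
      fun β hβ => ih β hβ s t fun γ hγ => h γ (hγ.trans hβ)

/-- A uniform unfolding that replaces the zero, successor and limit cases, so later inductions need
only well-foundedness. -/
theorem weakApprox_iff_forall_lt (τ : Act) (S : LTS V Act) (T : LTS V' Act) (α : Ordinal.{0}) :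
    ∀ s t, WeakApprox τ S T α s t ↔
      ∀ γ < α, WeakMatch τ S T (WeakApprox τ S T γ) s t := by
  intro s t
  refine ⟨?_, weakApprox_of_forall_lt τ S T α s t⟩
  induction α using Ordinal.limitRecOn generalizing s t with
  | zero => intro _ γ hγ; exact absurd hγ not_lt_zero
  | add_one β ih =>
    rw [← Order.succ_eq_add_one]
    intro h γ hγ
    have h' : WeakMatch τ S T (WeakApprox τ S T β) s t := (weakApprox_succ τ S T β s t).1 h
    refine h'.mono fun s' t' hst => ?_
    exact weakApprox_of_forall_lt τ S T γ s' t'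
      fun δ hδ => ih s' t' hst δ (hδ.trans_le (Order.lt_succ_iff.1 hγ))
  | limit l hl _ =>
    intro h γ hγ
    exact (weakApprox_succ τ S T γ s t).1
      ((weakApprox_limit τ S T l hl s t).1 h _ (hl.succ_lt hγ))

theorem weakApprox_antitone {τ : Act} {S : LTS V Act} {T : LTS V' Act} {α β : Ordinal.{0}}
    (h : α ≤ β) {s : V} {t : V'} (hst : WeakApprox τ S T β s t) : WeakApprox τ S T α s t :=
  weakApprox_of_forall_lt τ S T α s t
    fun γ hγ => (weakApprox_iff_forall_lt τ S T β s t).1 hst γ (hγ.trans_le h)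

theorem WeakSim.weakApprox {τ : Act} {S : LTS V Act} {T : LTS V' Act} (α : Ordinal.{0})
    {s : V} {t : V'} (h : WeakSim τ S T s t) : WeakApprox τ S T α s t := by
  induction α using WellFoundedLT.induction generalizing s t with
  | ind α ih =>
    exact weakApprox_of_forall_lt τ S T α s t
      fun γ hγ => (isWeakSimulation_weakSim τ S T s t h).mono fun _ _ h' => ih γ hγ h'

end General

/-! ### Transfer along bounded morphisms -/

section Embedding

variable {Act : Type v}

/-- A map onto a part of `T'` that is closed under steps, reflecting and preserving them. -/
def IsBoundedMorphism {V : Type u} {V' : Type w} (T : LTS V Act) (T' : LTS V' Act)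
    (f : V → V') : Prop :=
  ∀ s a t', T'.step (f s) a t' ↔ ∃ t, T.step s a t ∧ f t = t'

variable {V : Type u} {W : Type w}

theorem IsBoundedMorphism.silent_iff {T : LTS V Act} {T' : LTS W Act} {f : V → W}
    (hf : IsBoundedMorphism T T' f) (τ : Act) (s : V) (t' : W) :
    T'.silent τ (f s) t' ↔ ∃ t, T.silent τ s t ∧ f t = t' := by
  constructor
  · intro h
    induction h with
    | refl => exact ⟨s, .refl, rfl⟩
    | tail _ hbc ih =>
      obtain ⟨t, ht, rfl⟩ := ih
      obtain ⟨u, hu, rfl⟩ := (hf _ _ _).1 hbc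
      exact ⟨u, ht.tail hu, rfl⟩
  · rintro ⟨t, ht, rfl⟩
    exact Relation.ReflTransGen.lift f (fun a b hab => (hf _ _ _).2 ⟨b, hab, rfl⟩) _ _ ht

theorem IsBoundedMorphism.weakStep_iff {T : LTS V Act} {T' : LTS W Act} {f : V → W}
    (hf : IsBoundedMorphism T T' f) (τ a : Act) (s : V) (t' : W) :
    T'.weakStep τ (f s) a t' ↔ ∃ t, T.weakStep τ s a t ∧ f t = t' := by
  constructor
  · rintro (⟨ha, h⟩ | ⟨ha, x, y, hx, hxy, hy⟩)
    · obtain ⟨t, ht, rfl⟩ := (hf.silent_iff τ _ _).1 h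
      exact ⟨t, .inl ⟨ha, ht⟩, rfl⟩
    · obtain ⟨x', hx', rfl⟩ := (hf.silent_iff τ _ _).1 hx
      obtain ⟨y', hxy', rfl⟩ := (hf _ _ _).1 hxy
      obtain ⟨t, ht, rfl⟩ := (hf.silent_iff τ _ _).1 hy
      exact ⟨t, .inr ⟨ha, x', y', hx', hxy', ht⟩, rfl⟩
  · rintro ⟨t, ⟨ha, h⟩ | ⟨ha, x, y, hx, hxy, hy⟩, rfl⟩
    · exact .inl ⟨ha, (hf.silent_iff τ _ _).2 ⟨t, h, rfl⟩⟩
    · exact .inr ⟨ha, f x, f y, (hf.silent_iff τ _ _).2 ⟨x, hx, rfl⟩,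
        (hf _ _ _).2 ⟨y, hxy, rfl⟩, (hf.silent_iff τ _ _).2 ⟨t, hy, rfl⟩⟩

variable {W₁ W₂ : Type*} {S : LTS V Act} {S' : LTS W Act} {T : LTS W₁ Act} {T' : LTS W₂ Act}
  {f : V → W} {g : W₁ → W₂}

theorem weakMatch_map_iff (hf : IsBoundedMorphism S S' f) (hg : IsBoundedMorphism T T' g)
    (τ : Act) (R : W → W₂ → Prop) (s : V) (t : W₁) :
    WeakMatch τ S' T' R (f s) (g t) ↔ WeakMatch τ S T (fun x y => R (f x) (g y)) s t := by
  constructor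
  · intro h a s' hs
    obtain ⟨t', ht, hr⟩ := h a (f s') ((hf _ _ _).2 ⟨s', hs, rfl⟩)
    obtain ⟨u, hu, rfl⟩ := (hg.weakStep_iff τ _ _ _).1 ht
    exact ⟨u, hu, hr⟩
  · intro h a s' hs
    obtain ⟨v, hv, rfl⟩ := (hf _ _ _).1 hs
    obtain ⟨t', ht, hr⟩ := h a v hv
    exact ⟨g t', (hg.weakStep_iff τ _ _ _).2 ⟨t', ht, rfl⟩, hr⟩

theorem weakSim_of_map (hf : IsBoundedMorphism S S' f) (hg : IsBoundedMorphism T T' g)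
    {τ : Act} {s : V} {t : W₁} (h : WeakSim τ S' T' (f s) (g t)) : WeakSim τ S T s t :=
  ⟨fun x y => WeakSim τ S' T' (f x) (g y),
    fun x y hxy => (weakMatch_map_iff hf hg τ _ x y).1 (isWeakSimulation_weakSim τ S' T' _ _ hxy),
    h⟩

theorem weakApprox_map (hf : IsBoundedMorphism S S' f) (hg : IsBoundedMorphism T T' g)
    {τ : Act} (α : Ordinal.{0}) {s : V} {t : W₁} (h : WeakApprox τ S T α s t) :
    WeakApprox τ S' T' α (f s) (g t) := by
  induction α using WellFoundedLT.induction generalizing s t with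
  | ind α ih =>
    refine weakApprox_of_forall_lt τ S' T' α _ _ fun γ hγ => (weakMatch_map_iff hf hg τ _ s t).2 ?_
    exact ((weakApprox_iff_forall_lt τ S T α s t).1 h γ hγ).mono fun _ _ h' => ih γ hγ h'

end Embedding

end LTS

namespace OneCounterNet

open LTS Ordinal

/-! ### Monotonicity in the counters -/

section Monotonicity

variable {Q : Type u} {Q' : Type w} {Act : Type v} [Finite Q] [Finite Q'] [Finite Act]

theorem step_add (N : OneCounterNet Q Act) (k : ℕ) {s t : Q × ℕ} {a : Act}
    (h : N.lts.step s a t) : N.lts.step (s.1, s.2 + k) a (t.1, t.2 + k) := by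
  obtain ⟨d, hd, he⟩ := h
  exact ⟨d, hd, by push_cast; omega⟩

theorem silent_add (N : OneCounterNet Q Act) (τ : Act) (k : ℕ) {s t : Q × ℕ}
    (h : N.lts.silent τ s t) : N.lts.silent τ (s.1, s.2 + k) (t.1, t.2 + k) :=
  Relation.ReflTransGen.lift (fun c : Q × ℕ => (c.1, c.2 + k))
    (fun _ _ hab => N.step_add k hab) _ _ h

theorem weakStep_add (N : OneCounterNet Q Act) (τ : Act) (k : ℕ) {s t : Q × ℕ} {a : Act}
    (h : N.lts.weakStep τ s a t) : N.lts.weakStep τ (s.1, s.2 + k) a (t.1, t.2 + k) := by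
  rcases h with ⟨ha, h⟩ | ⟨ha, x, y, hx, hxy, hy⟩
  · exact .inl ⟨ha, N.silent_add τ k h⟩
  · exact .inr ⟨ha, _, _, N.silent_add τ k hx, N.step_add k hxy, N.silent_add τ k hy⟩

/-- Without zero tests, adding a constant to the counter preserves steps: Spoiler with less has no
new moves, Duplicator with more loses none. -/
theorem weakApprox_mono (τ : Act) (M : OneCounterNet Q Act) (N : OneCounterNet Q' Act)
    (α : Ordinal.{0}) {p : Q} {q : Q'} {m m' n n' : ℕ} (hm : m' ≤ m) (hn : n ≤ n')
    (h : WeakApprox τ M.lts N.lts α (p, m) (q, n)) :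
    WeakApprox τ M.lts N.lts α (p, m') (q, n') := by
  obtain ⟨j, rfl⟩ := Nat.exists_eq_add_of_le hm
  obtain ⟨k, rfl⟩ := Nat.exists_eq_add_of_le hn
  clear hm hn
  induction α using WellFoundedLT.induction generalizing p q m' n with
  | ind α ih =>
    refine weakApprox_of_forall_lt _ _ _ _ _ _ fun γ hγ a s' hs => ?_
    obtain ⟨t', ht, hr⟩ := (weakApprox_iff_forall_lt _ _ _ _ _ _).1 h γ hγ a _ (M.step_add j hs)
    exact ⟨_, N.weakStep_add τ k ht, ih γ hγ hr⟩

end Monotonicity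

/-! ### Convergence at `ω ^ 2` -/

section Convergence

variable {Q : Type u} {Q' : Type w} {Act : Type v} [Finite Q] [Finite Q'] [Finite Act]

/-- The least counter value with which Spoiler, in state `p`, wins the game of length `ω * k`
against every configuration of Duplicator in state `q`. -/
noncomputable def threshold (τ : Act) (M : OneCounterNet Q Act) (N : OneCounterNet Q' Act)
    (k : ℕ) (pq : Q × Q') : ℕ∞ :=
  ⨅ m ∈ {m : ℕ | ∀ n, ¬ WeakApprox τ M.lts N.lts (ω * (k : Ordinal.{0})) (pq.1, m) (pq.2, n)},
    (m : ℕ∞)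

theorem lt_threshold_iff (τ : Act) (M : OneCounterNet Q Act) (N : OneCounterNet Q' Act)
    (k : ℕ) (p : Q) (q : Q') (m : ℕ) :
    (m : ℕ∞) < threshold τ M N k (p, q) ↔
      ∃ n, WeakApprox τ M.lts N.lts (ω * (k : Ordinal.{0})) (p, m) (q, n) := by
  constructor
  · intro h
    by_contra! hn
    exact absurd h (not_lt.2 (iInf₂_le m hn))
  · rintro ⟨n, hn⟩
    refine lt_of_lt_of_le (b := ((m + 1 : ℕ) : ℕ∞)) (by exact_mod_cast Nat.lt_succ_self m)
      (le_iInf₂ fun m' hm' => ?_)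
    by_contra! hlt
    have hle : m' ≤ m := Nat.lt_succ_iff.1 (by exact_mod_cast hlt)
    exact hm' n (weakApprox_mono τ M N _ hle le_rfl hn)

theorem threshold_antitone (τ : Act) (M : OneCounterNet Q Act) (N : OneCounterNet Q' Act) :
    Antitone (threshold τ M N) := by
  intro k l hkl pq
  refine le_iInf₂ fun m hm => iInf₂_le m fun n h => hm n (weakApprox_antitone ?_ h)
  exact mul_le_mul_right (by exact_mod_cast hkl) _

theorem exists_threshold_eq_succ (τ : Act) (M : OneCounterNet Q Act) (N : OneCounterNet Q' Act) :
    ∃ k, threshold τ M N k = threshold τ M N (k + 1) := by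
  -- The order dual turns the descending thresholds into an ascending chain.
  obtain ⟨k, hk⟩ := WellFoundedGT.monotone_chain_condition
    (α := (Q × Q' → ℕ∞)ᵒᵈ) ⟨threshold τ M N, threshold_antitone τ M N⟩
  exact ⟨k, hk (k + 1) (Nat.le_succ k)⟩

/-- If Duplicator has an answer at each level `β + n`, and the levels `β` and `β + ω` agree on what
can be won from arbitrarily large counter values, then one answer serves all these levels. -/
theorem isWeakSimulation_weakApprox_add_omega (τ : Act) (M : OneCounterNet Q Act)
    (N : OneCounterNet Q' Act) (β : Ordinal.{0})
    (hβ : ∀ p q m, (∃ n, WeakApprox τ M.lts N.lts β (p, m) (q, n)) →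
      ∃ n, WeakApprox τ M.lts N.lts (β + ω) (p, m) (q, n)) :
    IsWeakSimulation τ M.lts N.lts (WeakApprox τ M.lts N.lts (β + ω)) := by
  rintro s t hst a ⟨p', m'⟩ hs
  have hans : ∀ i : ℕ, ∃ t', N.lts.weakStep τ t a t' ∧
      WeakApprox τ M.lts N.lts (β + i) (p', m') t' := fun i =>
    (weakApprox_iff_forall_lt _ _ _ _ _ _).1 hst (β + i)
      (by gcongr; exact natCast_lt_omega0 i) a _ hs
  choose t' hstep happ using hans
  -- Pigeonhole: one control state serves for infinitely many stages `i`, hence for arbitrarily late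
  -- ones.
  obtain ⟨q', hq'⟩ := Finite.exists_infinite_fiber (fun i => (t' i).1)
  have hinf : Set.Infinite ((fun i => (t' i).1) ⁻¹' {q'}) := Set.infinite_coe_iff.1 hq'
  by_cases hb : BddAbove {n | N.lts.weakStep τ t a (q', n)}
  · obtain ⟨b, hb⟩ := hb
    have hne : {n | N.lts.weakStep τ t a (q', n)}.Nonempty := by
      obtain ⟨i, hi⟩ := hinf.nonempty
      obtain rfl : (t' i).1 = q' := hi
      exact ⟨(t' i).2, hstep i⟩
    have hmem := Nat.sSup_mem hne ⟨b, hb⟩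
    -- The largest reachable counter value dominates all answers in `q'`.
    refine ⟨_, hmem, ?_⟩
    refine (weakApprox_limit τ _ _ _ (isSuccLimit_add _ isSuccLimit_omega0) _ _).2 fun γ hγ => ?_
    obtain ⟨δ, hδ, hγδ⟩ := (lt_add_iff omega0_ne_zero).1 hγ
    obtain ⟨c, rfl⟩ := lt_omega0.1 hδ
    obtain ⟨i, hi, hci⟩ := hinf.exists_gt c
    obtain rfl : (t' i).1 = q' := hi
    refine weakApprox_antitone (β := β + i) (hγδ.trans ?_)
      (weakApprox_mono τ M N _ le_rfl (le_csSup ⟨b, hb⟩ (hstep i)) (happ i))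
    gcongr
  · obtain ⟨i, hi⟩ := hinf.nonempty
    obtain rfl : (t' i).1 = q' := hi
    -- Some `n`, perhaps unreachable, wins at level `β + ω`; unboundedness supplies a reachable
    -- value above it.
    obtain ⟨n, hn⟩ := hβ p' (t' i).1 m'
      ⟨(t' i).2, weakApprox_antitone le_self_add (happ i)⟩
    obtain ⟨n', hn', hlt⟩ := not_bddAbove_iff.1 hb n
    exact ⟨_, hn', weakApprox_mono τ M N _ le_rfl hlt.le hn⟩

theorem weakApprox_omega0_sq (τ : Act) (M : OneCounterNet Q Act) (N : OneCounterNet Q' Act) :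
    WeakApprox τ M.lts N.lts (ω ^ 2) = WeakSim τ M.lts N.lts := by
  ext s t
  refine ⟨fun h => ?_, fun h => h.weakApprox _⟩
  obtain ⟨k, hk⟩ := exists_threshold_eq_succ τ M N
  have hsucc : ω * ((k + 1 : ℕ) : Ordinal.{0}) = ω * (k : Ordinal.{0}) + ω := by
    rw [Nat.cast_succ, mul_add_one]
  refine ⟨_, isWeakSimulation_weakApprox_add_omega τ M N (ω * (k : Ordinal.{0})) ?_, ?_⟩
  · intro p q m hm
    rwa [← hsucc, ← lt_threshold_iff, ← hk, lt_threshold_iff]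
  · rw [← hsucc]
    refine weakApprox_antitone ?_ h
    rw [pow_two]
    exact mul_le_mul_right (natCast_lt_omega0 _).le _

end Convergence

/-! ### The nets `N_i`: optimality of `ω ^ 2` -/

section LowerBound

theorem loopNet_step_iff (s : Unit × ℕ) (b : ExAct) (t : Unit × ℕ) :
    loopNet.lts.step s b t ↔ b = ExAct.a ∧ t = s := by
  obtain ⟨⟨⟩, m⟩ := s
  obtain ⟨⟨⟩, m'⟩ := t
  simp only [lts, loopNet, Set.mem_singleton_iff, Prod.mk.injEq, true_and, and_true]
  constructor
  · rintro ⟨d, ⟨rfl, rfl⟩, h⟩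
    exact ⟨rfl, by omega⟩
  · rintro ⟨rfl, rfl⟩
    exact ⟨0, ⟨rfl, rfl⟩, by simp⟩

theorem weakApprox_succ_loopNet {V : Type*} (T : LTS V ExAct) (α : Ordinal.{0}) (m : ℕ) (t : V) :
    WeakApprox ExAct.tau loopNet.lts T (Order.succ α) ((), m) t ↔
      ∃ t', T.weakStep ExAct.tau t ExAct.a t' ∧
        WeakApprox ExAct.tau loopNet.lts T α ((), m) t' := by
  rw [weakApprox_succ]
  constructor
  · intro h
    exact h _ _ ((loopNet_step_iff _ _ _).2 ⟨rfl, rfl⟩)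
  · intro h b s' hs
    obtain ⟨rfl, rfl⟩ := (loopNet_step_iff _ _ _).1 hs
    exact h

theorem chainNet_step_dec {i : ℕ} (j : Fin i) (n : ℕ) :
    (chainNet i).lts.step (Sum.inl j.succ, n + 1) ExAct.a (Sum.inl j.succ, n) :=
  ⟨-1, ⟨j, .inl rfl⟩, by push_cast; ring⟩

theorem chainNet_weakStep_next {i : ℕ} (j : Fin i) (n : ℕ) :
    (chainNet i).lts.weakStep ExAct.tau (Sum.inl j.castSucc, 0) ExAct.a (Sum.inl j.succ, n) := by
  refine .inr ⟨by simp, (Sum.inr j, n), _, ?_, ⟨0, ⟨j, .inr (.inr (.inr rfl))⟩, by simp⟩, .refl⟩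
  refine .head (b := (Sum.inr j, 0)) ⟨0, ⟨j, .inr (.inl rfl)⟩, by simp⟩ ?_
  induction n with
  | zero => exact .refl
  | succ n ih => exact ih.tail ⟨1, ⟨j, .inr (.inr (.inl rfl))⟩, by push_cast; ring⟩

/-- Each counter unit pays for one extra round in the loop. -/
theorem weakApprox_chainNet_of_zero {i : ℕ} (j : Fin i) (α : Ordinal.{0}) (m : ℕ)
    (h : WeakApprox ExAct.tau loopNet.lts (chainNet i).lts α ((), m) (Sum.inl j.succ, 0)) (n : ℕ) :
    WeakApprox ExAct.tau loopNet.lts (chainNet i).lts (α + n) ((), m) (Sum.inl j.succ, n) := by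
  induction n with
  | zero => simpa using h
  | succ n ih =>
    have hα : α + ((n + 1 : ℕ) : Ordinal.{0}) = Order.succ (α + n) := by
      rw [Nat.cast_succ, ← add_assoc, Order.succ_eq_add_one]
    rw [hα, weakApprox_succ_loopNet]
    exact ⟨_, .inr ⟨by simp, _, _, .refl, chainNet_step_dec j n, .refl⟩, ih⟩

theorem weakApprox_chainNet (i m r : ℕ) (j : Fin (i + 1)) (hj : (j : ℕ) + r = i) :
    WeakApprox ExAct.tau loopNet.lts (chainNet i).lts (ω * (r : Ordinal.{0}))
      ((), m) (Sum.inl j, 0) := by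
  induction r generalizing j with
  | zero => simp [weakApprox_zero]
  | succ r ih =>
    obtain ⟨j', rfl⟩ : ∃ j' : Fin i, j = j'.castSucc := ⟨⟨j, by omega⟩, rfl⟩
    rw [Nat.cast_succ, mul_add_one,
      weakApprox_limit _ _ _ _ (isSuccLimit_add _ isSuccLimit_omega0)]
    intro γ hγ
    obtain ⟨δ, hδ, hγδ⟩ := (lt_add_iff omega0_ne_zero).1 hγ
    obtain ⟨n, rfl⟩ := lt_omega0.1 hδ
    -- Pumping to `n` covers `ω * r + n`; the round that enters the next loop makes the successor
    -- available as well.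
    refine weakApprox_antitone (hγδ.trans (Order.le_succ _)) ?_
    rw [weakApprox_succ_loopNet]
    refine ⟨_, chainNet_weakStep_next j' n, weakApprox_chainNet_of_zero j' _ m (ih _ ?_) n⟩
    simp at hj ⊢
    omega

/-- A bound on the number of visible steps, weakly decreasing along silent steps. -/
def chainRank (i : ℕ) : (Fin (i + 1) ⊕ Fin i) × ℕ → ℕ ×ₗ ℕ
  | (Sum.inl j, n) => toLex (2 * (i - j) + 1, n)
  | (Sum.inr j, _) => toLex (2 * (i - j), 0)

/-- Entering `q'_j` lowers the first component; pumping there keeps the rank, whose second component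
ignores the counter. -/
theorem chainRank_step_tau {i : ℕ} {s t : (Fin (i + 1) ⊕ Fin i) × ℕ}
    (h : (chainNet i).lts.step s ExAct.tau t) : chainRank i t ≤ chainRank i s := by
  obtain ⟨d, ⟨j, h | h | h | h⟩, he⟩ := h <;> obtain ⟨q, n⟩ := s <;> obtain ⟨q', n'⟩ := t <;>
    simp only [Prod.mk.injEq, reduceCtorEq, false_and, and_false] at h
  · obtain ⟨rfl, -, -, rfl⟩ := h
    simp [chainRank, Prod.Lex.toLex_le_toLex]
  · obtain ⟨rfl, -, -, rfl⟩ := h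
    simp [chainRank]

/-- The loop lowers the counter; leaving `q'_j` lowers the first component from `2 * (i - j)` to one
less. -/
theorem chainRank_step_a {i : ℕ} {s t : (Fin (i + 1) ⊕ Fin i) × ℕ}
    (h : (chainNet i).lts.step s ExAct.a t) : chainRank i t < chainRank i s := by
  obtain ⟨d, ⟨j, h | h | h | h⟩, he⟩ := h <;> obtain ⟨q, n⟩ := s <;> obtain ⟨q', n'⟩ := t <;>
    simp only [Prod.mk.injEq, reduceCtorEq, false_and, and_false] at h
  · obtain ⟨rfl, -, rfl, rfl⟩ := h
    simp only [chainRank, Prod.Lex.toLex_lt_toLex]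
    right
    simp at he ⊢
    omega
  · obtain ⟨rfl, -, -, rfl⟩ := h
    have := j.isLt
    simp only [chainRank, Prod.Lex.toLex_lt_toLex, Fin.val_succ]
    left
    omega

theorem chainRank_silent {i : ℕ} {s t : (Fin (i + 1) ⊕ Fin i) × ℕ}
    (h : (chainNet i).lts.silent ExAct.tau s t) : chainRank i t ≤ chainRank i s := by
  induction h with
  | refl => exact le_rfl
  | tail _ hbc ih => exact (chainRank_step_tau hbc).trans ih

/-- Spoiler can play `a` forever, while each answer strictly lowers a rank in a well-order. -/
theorem not_weakSim_chainNet (i m : ℕ) (t : (Fin (i + 1) ⊕ Fin i) × ℕ) :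
    ¬ WeakSim ExAct.tau loopNet.lts (chainNet i).lts ((), m) t := by
  induction hr : chainRank i t using WellFoundedLT.induction generalizing t with
  | ind r ih =>
    subst hr
    intro h
    obtain ⟨t', ⟨ha, -⟩ | ⟨-, x, y, hx, hxy, hy⟩, h'⟩ :=
      isWeakSimulation_weakSim _ _ _ _ _ h _ _ ((loopNet_step_iff _ _ _).2 ⟨rfl, rfl⟩)
    · cases ha
    · exact ih _ (((chainRank_silent hy).trans_lt (chainRank_step_a hxy)).trans_le
        (chainRank_silent hx)) t' rfl h'

end LowerBound

/-! ### Disjoint unions and the single-net counterexample -/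

section Sum

variable {Q₁ Q₂ Q Act : Type*} [Finite Q₁] [Finite Q₂] [Finite Q] [Finite Act]

/-- The disjoint union of two nets, on states renamed along `e`. -/
def sum (M : OneCounterNet Q₁ Act) (N : OneCounterNet Q₂ Act) (e : Q₁ ⊕ Q₂ ≃ Q) :
    OneCounterNet Q Act where
  δ := {x | (∃ y ∈ M.δ, x = (e (.inl y.1), y.2.1, y.2.2.1, e (.inl y.2.2.2))) ∨
    ∃ y ∈ N.δ, x = (e (.inr y.1), y.2.1, y.2.2.1, e (.inr y.2.2.2))}
  effect_mem := by
    rintro p a d q (⟨y, hy, h⟩ | ⟨y, hy, h⟩) <;> simp only [Prod.mk.injEq] at h <;>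
      obtain ⟨-, -, rfl, -⟩ := h
    · exact M.effect_mem _ _ _ _ hy
    · exact N.effect_mem _ _ _ _ hy

theorem isBoundedMorphism_sum_inl (M : OneCounterNet Q₁ Act) (N : OneCounterNet Q₂ Act)
    (e : Q₁ ⊕ Q₂ ≃ Q) :
    IsBoundedMorphism M.lts (M.sum N e).lts fun c => (e (.inl c.1), c.2) := by
  rintro ⟨p, m⟩ a ⟨q, n⟩
  constructor
  · rintro ⟨d, ⟨y, hy, h⟩ | ⟨y, hy, h⟩, he⟩ <;>
      simp only [Prod.mk.injEq, EmbeddingLike.apply_eq_iff_eq, Sum.inl.injEq, reduceCtorEq,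
        false_and] at h
    obtain ⟨rfl, rfl, rfl, rfl⟩ := h
    exact ⟨(y.2.2.2, n), ⟨_, hy, he⟩, rfl⟩
  · rintro ⟨⟨q', n'⟩, ⟨d, hd, he⟩, h⟩
    obtain ⟨rfl, rfl⟩ := Prod.mk.inj h
    exact ⟨d, .inl ⟨_, hd, rfl⟩, he⟩

theorem isBoundedMorphism_sum_inr (M : OneCounterNet Q₁ Act) (N : OneCounterNet Q₂ Act)
    (e : Q₁ ⊕ Q₂ ≃ Q) :
    IsBoundedMorphism N.lts (M.sum N e).lts fun c => (e (.inr c.1), c.2) := by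
  rintro ⟨p, m⟩ a ⟨q, n⟩
  constructor
  · rintro ⟨d, ⟨y, hy, h⟩ | ⟨y, hy, h⟩, he⟩ <;>
      simp only [Prod.mk.injEq, EmbeddingLike.apply_eq_iff_eq, Sum.inr.injEq, reduceCtorEq,
        false_and] at h
    obtain ⟨rfl, rfl, rfl, rfl⟩ := h
    exact ⟨(y.2.2.2, n), ⟨_, hy, he⟩, rfl⟩
  · rintro ⟨⟨q', n'⟩, ⟨d, hd, he⟩, h⟩
    obtain ⟨rfl, rfl⟩ := Prod.mk.inj h
    exact ⟨d, .inr ⟨_, hd, rfl⟩, he⟩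

end Sum

/-- Both summands embed by bounded morphisms: the approximant passes to the union, and a simulation
there would pull back to the summands. -/
theorem exists_weakApprox_ne_weakSim (α : Ordinal.{0}) (hα : α < ω ^ 2) :
    ∃ (n : ℕ) (N : OneCounterNet (Fin n) ExAct),
      WeakApprox ExAct.tau N.lts N.lts α ≠ WeakSim ExAct.tau N.lts N.lts := by
  rw [pow_two, lt_mul_iff_of_isSuccLimit isSuccLimit_omega0] at hα
  obtain ⟨β, hβ, hα⟩ := hα
  obtain ⟨i, rfl⟩ := lt_omega0.1 hβ
  have hM := isBoundedMorphism_sum_inl loopNet (chainNet i) (Fintype.equivFin _)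
  have hN := isBoundedMorphism_sum_inr loopNet (chainNet i) (Fintype.equivFin _)
  refine ⟨_, loopNet.sum (chainNet i) (Fintype.equivFin _), fun h => ?_⟩
  have happ := weakApprox_map hM hN α
    (weakApprox_antitone hα.le (weakApprox_chainNet i 0 i 0 (by simp)))
  rw [h] at happ
  exact not_weakSim_chainNet i 0 _ (weakSim_of_map hM hN happ)

end OneCounterNet

theorem mainTheorem4 :
    -- convergence at level `ω ^ 2`, for any two nets over the same actions (possibly equal)
    (∀ {Q : Type u} {Q' : Type w} {Act : Type v} [Finite Q] [Finite Q'] [Finite Act] (τ : Act)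
        (M : OneCounterNet Q Act) (N : OneCounterNet Q' Act),
        LTS.WeakApprox τ M.lts N.lts (Ordinal.omega0 ^ 2) = LTS.WeakSim τ M.lts N.lts) ∧
    -- the nets `N_i` show that there is no convergence at `ω * i`
    (∀ i m : ℕ,
        LTS.WeakApprox ExAct.tau loopNet.lts (chainNet i).lts (Ordinal.omega0 * (i : Ordinal.{0}))
            ((), m) (Sum.inl 0, 0) ∧
          ¬ LTS.WeakSim ExAct.tau loopNet.lts (chainNet i).lts ((), m) (Sum.inl 0, 0)) ∧
    -- hence no level below `ω ^ 2` suffices in general, even within a single net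
    (∀ α < (Ordinal.omega0 : Ordinal.{0}) ^ 2,
        ∃ (n : ℕ) (N : OneCounterNet (Fin n) ExAct),
          LTS.WeakApprox ExAct.tau N.lts N.lts α ≠ LTS.WeakSim ExAct.tau N.lts N.lts) :=
  ⟨fun τ M N => OneCounterNet.weakApprox_omega0_sq τ M N,
    fun i m => ⟨OneCounterNet.weakApprox_chainNet i m i 0 (by simp),
      OneCounterNet.not_weakSim_chainNet i m _⟩,
    OneCounterNet.exists_weakApprox_ne_weakSim⟩
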